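/- \textbf{Setting.} A graph on $N$ nodes is given by a graph shift operator (GSO) $S\in\mathbb{R}^{N\times N}$. An $L$-layer GNN $\Phi$ with $K$ taps and pointwise nonlinearity $\sigma:\mathbb{R}\to\mathbb{R}$ sends an input signal $q\in\mathbb{R}^N$ to $X^{(L)}$, where $X^{(0)}=q$ (one feature) and $$X^{(l)}=\sigma\Big(\sum_{k=0}^{K-1}S^kX^{(l-1)}H^{(l)}_k\Big),\qquad H^{(l)}_k\in\mathbb{R}^{F_{l-1}\times F_l},\quad F_0=1 ;$$ write $\Phi(S,q)[:,f]$ for the $f$-th column of $X^{(L)}$. The filter of layer $l$ from feature $i$ to feature $j$ has taps $h_k=H^{(l)}_k[i,j]$, operator $H(S)=\sum_k h_kS^k$ and frequency response $h(\lambda)=\sum_k h_k\lambda^k$. All norms are Euclidean norms of vectors and the induced operator norms of matrices. For operators $A,B$ taking $M$ signals to one signal put $$\|A-B\|_{\mathcal P}=\min_{\Pi}\ \max_{\|q^{(1)}\|=\dots=\|q^{(M)}\|=1}\big\|\Pi^TA(q^{(1)},\dots,q^{(M)})-B(\Pi^Tq^{(1)},\dots,\Pi^Tq^{(M)})\big\|,$$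 $\Pi$ ranging over the permutation matrices, and $\|a-b\|_{\mathcal P}=\min_\Pi\|\Pi^Ta-b\|$ for vectors $a,b$. The R-PEARL encoding of $q^{(1)},\dots,q^{(M)}$ is $P_S=\frac1M\sum_{m=1}^M\Phi(S,q^{(m)})$, and the B-PEARL encoding is $P^B_S=\sum_{m=1}^N\Phi(S,e_m)$, with $e_m$ the standard basis vectors. \textbf{Corollary (Stability).} Let $N,L\ge 0$, $F\ge1$ and $C\ge 0$. There is a function $r:\mathbb{R}\to\mathbb{R}$ with $r(\varepsilon)=\mathcal{O}(\varepsilon^2)$ as $\varepsilon\to0$, depending only on $N,L,F,C$ (in particular independent of the eigenvalues and eigengaps of the GSO, and of $M$ and $K$), such that the following holds. Let $\tilde S=S+E$ with $\|E\|\le\varepsilon$. Let $\Phi$ be an $L$-layer GNN with at most $F$ features in each hidden layer such that $|\sigma(a)-\sigma(b)|\le|a-b|$ for all $a,b$, $\sigma(0)=0$, every filter satisfies $\|H(S)\|\le 1/F$, and every filter is Lipschitz with constant $C$: $|h(\lambda_2)-h(\lambda_1)|\le C|\lambda_2-\lambda_1|$ for all $\lambda_1,\lambda_2\in I$, where either $I=\mathbb{R}$,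 or $S$ and $E$ are symmetric and $I\subseteq\mathbb{R}$ contains the spectra of $S$ and $\tilde S$. Then, for every output feature $f$ and every number $M$ of samples, $$\Big\|\frac1M\sum_{m=1}^M\Phi(S,\cdot)[:,f]-\frac1M\sum_{m=1}^M\Phi(\tilde S,\cdot)[:,f]\Big\|_{\mathcal P}\le C\,(1+8\sqrt N)\,L\,\varepsilon+r(\varepsilon),$$ both with $M$ separate inputs (that is, for the R-PEARL encodings $P_S[:,f]$ and $P_{\tilde S}[:,f]$ as operators of $(q^{(1)},\dots,q^{(M)})$) and with a single input common to all summands. The B-PEARL encodings, averaged over their $M=N$ inputs, satisfy the same bound: $\big\|\frac1N P^B_S[:,f]-\frac1N P^B_{\tilde S}[:,f]\big\|_{\mathcal P}\le C\,(1+8\sqrt N)\,L\,\varepsilon+r(\varepsilon)$. -/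

import Mathlib

open scoped ENNReal

noncomputable section

namespace Pearl

/-- Graph signals on `N` nodes, with the Euclidean norm. -/
abbrev Signal (N : ℕ) : Type := EuclideanSpace ℝ (Fin N)

/-- The spectral (`ℓ²` operator) norm of a square real matrix. -/
def opNorm {N : ℕ} (A : Matrix (Fin N) (Fin N) ℝ) : ℝ :=
  ‖Matrix.toEuclideanCLM (n := Fin N) (𝕜 := ℝ) A‖

/-- The graph filter `H(S) = ∑ₖ hₖ Sᵏ` with taps `h₀, …, h_{K-1}`. -/
def graphFilter {N K : ℕ} (h : Fin K → ℝ) (S : Matrix (Fin N) (Fin N) ℝ) :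
    Matrix (Fin N) (Fin N) ℝ :=
  ∑ k : Fin K, h k • S ^ (k : ℕ)

/-- The frequency response `h(x) = ∑ₖ hₖ xᵏ` of a filter. -/
def freqResponse {K : ℕ} (h : Fin K → ℝ) (x : ℝ) : ℝ :=
  ∑ k : Fin K, h k * x ^ (k : ℕ)

/-- The filter is Lipschitz with constant `C` on a set `I` of frequencies
(`I = Set.univ`: Lipschitz on the whole line). -/
def IsLipschitzFilterOn {K : ℕ} (C : ℝ) (I : Set ℝ) (h : Fin K → ℝ) : Prop :=
  ∀ x ∈ I, ∀ y ∈ I, |freqResponse h y - freqResponse h x| ≤ C * |y - x|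

/-- The data of a graph neural network with `K` taps per filter.  Layer `l + 1` maps `width l`
features to `width (l + 1)` features; the input has a single feature.  The number of layers in
use is a separate argument of `GNN.features`. -/
structure GNN (K : ℕ) where
  /-- number of features at each level -/
  width : ℕ → ℕ
  /-- the input signal has one feature -/
  width_zero : width 0 = 1
  /-- the coefficient matrices `H_k` of layer `l + 1` -/
  weight : (l : ℕ) → Fin K → Matrix (Fin (width l)) (Fin (width (l + 1))) ℝ
  /-- the pointwise nonlinearity -/
  act : ℝ → ℝ

/-- The taps of the filter of layer `l + 1` from input feature `i` to output feature `j`. -/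
def GNN.taps {K : ℕ} (Φ : GNN K) (l : ℕ) (i : Fin (Φ.width l)) (j : Fin (Φ.width (l + 1))) :
    Fin K → ℝ :=
  fun k => Φ.weight l k i j

/-- The features after `l` layers, on the graph with shift operator `S` and input signal `q`:
`X⁽⁰⁾ = q` and `X⁽ˡ⁺¹⁾ = σ(∑ₖ Sᵏ X⁽ˡ⁾ Hₖ)`. -/
def GNN.features {N K : ℕ} (Φ : GNN K) (S : Matrix (Fin N) (Fin N) ℝ) (q : Signal N) :
    (l : ℕ) → Matrix (Fin N) (Fin (Φ.width l)) ℝ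
  | 0 => Matrix.of fun v _ => q v
  | l + 1 => (∑ k : Fin K, S ^ (k : ℕ) * GNN.features Φ S q l * Φ.weight l k).map Φ.act

/-- The feature `Φ(S, q)[:, f]` of the output of the `L`-layer network. -/
def GNN.output {N K : ℕ} (Φ : GNN K) (L : ℕ) (f : Fin (Φ.width L))
    (S : Matrix (Fin N) (Fin N) ℝ) (q : Signal N) : Signal N :=
  WithLp.toLp 2 fun v => Φ.features S q L v f

/-- Feature `f` of the R-PEARL encoding: the mean of the outputs on the samples `q⁽¹⁾, …, q⁽ᴹ⁾`. -/
def rPearl {N K M : ℕ} (Φ : GNN K) (L : ℕ) (f : Fin (Φ.width L))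
    (S : Matrix (Fin N) (Fin N) ℝ) (q : Fin M → Signal N) : Signal N :=
  (1 / (M : ℝ)) • ∑ m : Fin M, Φ.output L f S (q m)

/-- Feature `f` of the B-PEARL encoding: the sum of the outputs on the standard basis vectors. -/
def bPearl {N K : ℕ} (Φ : GNN K) (L : ℕ) (f : Fin (Φ.width L))
    (S : Matrix (Fin N) (Fin N) ℝ) : Signal N :=
  ∑ m : Fin N, Φ.output L f S (EuclideanSpace.single m (1 : ℝ))

/-- The action `x ↦ Πᵀ x` of a permutation matrix on signals. -/
def permute {N : ℕ} (π : Equiv.Perm (Fin N)) (x : Signal N) : Signal N :=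
  WithLp.toLp 2 fun v => x (π v)

/-- Operator distance modulo permutation,
`min_Π max_{‖x‖ = 1} ‖Πᵀ (A x) - B (Πᵀ x)‖`, with values in `[0, ∞]`. -/
def opDist {N : ℕ} (A B : Signal N → Signal N) : ℝ≥0∞ :=
  ⨅ π : Equiv.Perm (Fin N), ⨆ (x : Signal N) (_ : ‖x‖ = 1),
    ‖permute π (A x) - B (permute π x)‖ₑ

/-- The same distance for operators with `M` input signals; all inputs have norm one and are
permuted by the same `Π`. -/
def opDistMulti {N M : ℕ} (A B : (Fin M → Signal N) → Signal N) : ℝ≥0∞ :=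
  ⨅ π : Equiv.Perm (Fin N), ⨆ (q : Fin M → Signal N) (_ : ∀ m, ‖q m‖ = 1),
    ‖permute π (A q) - B (fun m => permute π (q m))‖ₑ

/-- Distance modulo permutation of two signals, `min_Π ‖Πᵀ a - b‖`. -/
def signalDist {N : ℕ} (a b : Signal N) : ℝ≥0∞ :=
  ⨅ π : Equiv.Perm (Fin N), ‖permute π a - b‖ₑ

end Pearl

end

namespace Pearl

open Matrix Polynomial

/-! The identity permutation already gives the bound, so it suffices to compare the two networks on
one unit input. A filter moves by at most `C * (1 + 8 * √N) * ε`, with no eigengap involved. A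
polynomial Lipschitz on the whole line is affine, so its change is its slope times `E`. For
symmetric operators, an eigenvector of the perturbed operator is expanded in an eigenbasis of `S`:
divided differences of the response, at most `C` in size, multiply the coefficients of the
perturbation, and passing to all vectors costs `√N`. Through the layers, the bound `1 / F` and the
nonexpansive activation keep the total norm of the features entering a layer at most one. An error
bound `d` thus becomes `d + c * ε * (1 + F * d)`: each layer adds `c * ε` at first order, and the
rest is `ε ^ 2` times a polynomial in `ε`. -/

/-! ### Filters Lipschitz on the whole line -/

/-- The polynomial whose coefficients are the taps of a filter. -/
noncomputable def filterPoly {K : ℕ} (h : Fin K → ℝ) : ℝ[X] :=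
  ∑ k : Fin K, Polynomial.C (h k) * Polynomial.X ^ (k : ℕ)

theorem eval_filterPoly {K : ℕ} (h : Fin K → ℝ) (x : ℝ) :
    (filterPoly h).eval x = freqResponse h x := by
  simp [filterPoly, freqResponse, Polynomial.eval_finsetSum]

theorem aeval_filterPoly {N K : ℕ} (h : Fin K → ℝ) (S : Matrix (Fin N) (Fin N) ℝ) :
    Polynomial.aeval S (filterPoly h) = graphFilter h S := by
  simp [filterPoly, graphFilter, Algebra.smul_def]

/-- A polynomial that is Lipschitz on the whole line is affine. -/
theorem natDegree_le_one_of_lipschitz {p : ℝ[X]} {C : ℝ}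
    (hp : ∀ x y : ℝ, |p.eval y - p.eval x| ≤ C * |y - x|) : p.natDegree ≤ 1 := by
  by_contra hdeg
  have hlt : (Polynomial.X : ℝ[X]).degree < p.degree := by
    rw [Polynomial.degree_X, ← Nat.cast_one]
    exact Polynomial.coe_lt_degree.2 (not_le.1 hdeg)
  have ht := Polynomial.abs_div_tendsto_atTop_atTop_of_degree_gt p Polynomial.X hlt
    Polynomial.X_ne_zero
  -- For `x ≥ 1` the Lipschitz bound gives `|p x| ≤ |p 0| + C * x ≤ (|p 0| + C) * x`, against the
  -- growth of `p / X`.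
  obtain ⟨x, hx, hx1⟩ := ((ht.eventually_gt_atTop (|p.eval 0| + C)).and
    (Filter.eventually_ge_atTop 1)).exists
  have hx0 : 0 < x := by linarith
  have h := hp 0 x
  rw [Polynomial.eval_X, abs_div, abs_of_pos hx0, lt_div_iff₀ hx0] at hx
  rw [sub_zero, abs_of_pos hx0] at h
  have h2 : |p.eval x| ≤ |p.eval x - p.eval 0| + |p.eval 0| := by
    simpa using abs_add_le (p.eval x - p.eval 0) (p.eval 0)
  nlinarith [abs_nonneg (p.eval 0)]

theorem opNorm_nonneg {N : ℕ} (A : Matrix (Fin N) (Fin N) ℝ) : 0 ≤ opNorm A := norm_nonneg _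

theorem norm_toEuclideanCLM_le {N : ℕ} (A : Matrix (Fin N) (Fin N) ℝ) (x : Signal N) :
    ‖toEuclideanCLM (n := Fin N) (𝕜 := ℝ) A x‖ ≤ opNorm A * ‖x‖ :=
  ContinuousLinearMap.le_opNorm _ x

theorem opNorm_sub_comm {N : ℕ} (A B : Matrix (Fin N) (Fin N) ℝ) :
    opNorm (A - B) = opNorm (B - A) := by
  simp only [opNorm, map_sub]
  exact norm_sub_rev _ _

/-- Perturbation bound for filters that are Lipschitz on the whole line. -/
theorem opNorm_graphFilter_sub_le_of_lipschitz {N K : ℕ} {C : ℝ} {h : Fin K → ℝ}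
    (hh : IsLipschitzFilterOn C Set.univ h) (S E : Matrix (Fin N) (Fin N) ℝ) :
    opNorm (graphFilter h (S + E) - graphFilter h S) ≤ C * opNorm E := by
  have hp : ∀ x y : ℝ, |(filterPoly h).eval y - (filterPoly h).eval x| ≤ C * |y - x| := by
    intro x y
    simpa only [eval_filterPoly] using hh x (Set.mem_univ x) y (Set.mem_univ y)
  have haff := Polynomial.eq_X_add_C_of_natDegree_le_one (natDegree_le_one_of_lipschitz hp)
  have hb : |(filterPoly h).coeff 1| ≤ C := by
    have h1 := hp 0 1
    rw [haff] at h1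
    simpa using h1
  have hsub : graphFilter h (S + E) - graphFilter h S = (filterPoly h).coeff 1 • E := by
    rw [← aeval_filterPoly, ← aeval_filterPoly, haff]
    simp [Algebra.smul_def, mul_add]
  rw [hsub, opNorm, map_smul, norm_smul, Real.norm_eq_abs]
  exact mul_le_mul_of_nonneg_right hb (norm_nonneg _)

/-! ### Filters of symmetric shift operators -/

theorem isHermitian_graphFilter {N K : ℕ} (h : Fin K → ℝ) {S : Matrix (Fin N) (Fin N) ℝ}
    (hS : S.IsHermitian) : (graphFilter h S).IsHermitian := by
  unfold graphFilter Matrix.IsHermitian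
  rw [Matrix.conjTranspose_sum]
  refine Finset.sum_congr rfl fun k _ => ?_
  rw [Matrix.conjTranspose_smul, Matrix.conjTranspose_pow, hS.eq, star_trivial]

theorem inner_toEuclideanCLM_comm {N : ℕ} {A : Matrix (Fin N) (Fin N) ℝ} (hA : A.IsHermitian)
    (x y : Signal N) :
    inner ℝ (toEuclideanCLM (n := Fin N) (𝕜 := ℝ) A x) y =
      inner ℝ x (toEuclideanCLM (n := Fin N) (𝕜 := ℝ) A y) :=
  (Matrix.isSymmetric_toEuclideanLin_iff.mpr hA) x y

/-- A filter acts on an eigenvector of the shift operator through its frequency response. -/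
theorem toEuclideanCLM_graphFilter_of_eigenvector {N K : ℕ} (h : Fin K → ℝ)
    {S : Matrix (Fin N) (Fin N) ℝ} {u : Signal N} {c : ℝ}
    (hu : toEuclideanCLM (n := Fin N) (𝕜 := ℝ) S u = c • u) :
    toEuclideanCLM (n := Fin N) (𝕜 := ℝ) (graphFilter h S) u = freqResponse h c • u := by
  have hpow : ∀ k : ℕ, toEuclideanCLM (n := Fin N) (𝕜 := ℝ) (S ^ k) u = c ^ k • u := by
    intro k
    induction k with
    | zero => simp
    | succ k ih =>
      rw [pow_succ, map_mul, mul_apply_eq_comp, hu, map_smul, ih, smul_smul, pow_succ,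
        mul_comm]
  simp only [graphFilter, freqResponse, map_sum, map_smul, _root_.sum_apply,
    _root_.smul_apply, hpow, smul_smul, Finset.sum_smul]

theorem toEuclideanCLM_eigenvectorBasis {N : ℕ} {S : Matrix (Fin N) (Fin N) ℝ}
    (hS : S.IsHermitian) (i : Fin N) :
    toEuclideanCLM (n := Fin N) (𝕜 := ℝ) S (hS.eigenvectorBasis i) =
      hS.eigenvalues i • hS.eigenvectorBasis i := by
  ext v
  exact congrFun (hS.mulVec_eigenvectorBasis i) v

/-- On an eigenvector of `T`, the filters of `S` and `T` differ by at most `C` times the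
difference of the shift operators. -/
theorem norm_graphFilter_sub_eigenvector_le {N K : ℕ} {C : ℝ} (hC : 0 ≤ C) {I : Set ℝ}
    {h : Fin K → ℝ} (hh : IsLipschitzFilterOn C I h) {S T : Matrix (Fin N) (Fin N) ℝ}
    (hS : S.IsHermitian) (hSI : spectrum ℝ S ⊆ I) {c : ℝ} (hc : c ∈ I) {v : Signal N}
    (hv : toEuclideanCLM (n := Fin N) (𝕜 := ℝ) T v = c • v) :
    ‖toEuclideanCLM (n := Fin N) (𝕜 := ℝ) (graphFilter h T - graphFilter h S) v‖ ≤
      C * ‖toEuclideanCLM (n := Fin N) (𝕜 := ℝ) (T - S) v‖ := by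
  have hcoef : ∀ i, inner ℝ (hS.eigenvectorBasis i)
      (toEuclideanCLM (n := Fin N) (𝕜 := ℝ) (T - S) v) =
      (c - hS.eigenvalues i) * inner ℝ (hS.eigenvectorBasis i) v := by
    intro i
    rw [map_sub, _root_.sub_apply, inner_sub_right, hv,
      ← inner_toEuclideanCLM_comm hS, toEuclideanCLM_eigenvectorBasis, inner_smul_right,
      real_inner_smul_left]
    ring
  have hcoef' : ∀ i, inner ℝ (hS.eigenvectorBasis i)
      (toEuclideanCLM (n := Fin N) (𝕜 := ℝ) (graphFilter h T - graphFilter h S) v) =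
      (freqResponse h c - freqResponse h (hS.eigenvalues i)) *
        inner ℝ (hS.eigenvectorBasis i) v := by
    intro i
    rw [map_sub, _root_.sub_apply, inner_sub_right,
      toEuclideanCLM_graphFilter_of_eigenvector h hv,
      ← inner_toEuclideanCLM_comm (isHermitian_graphFilter h hS),
      toEuclideanCLM_graphFilter_of_eigenvector h (toEuclideanCLM_eigenvectorBasis hS i),
      inner_smul_right, real_inner_smul_left]
    ring
  refine le_of_sq_le_sq ?_ (by positivity)
  -- Parseval in the eigenbasis of `S` reduces the claim to single coefficients.
  rw [mul_pow, ← hS.eigenvectorBasis.sum_sq_norm_inner_right,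
    ← hS.eigenvectorBasis.sum_sq_norm_inner_right, Finset.mul_sum]
  refine Finset.sum_le_sum fun i _ => ?_
  rw [hcoef, hcoef', norm_mul, norm_mul, ← mul_pow, ← mul_assoc]
  have hl := hh _ (hSI (hS.eigenvalues_mem_spectrum_real i)) c hc
  simp only [Real.norm_eq_abs]
  gcongr

/-- Perturbation bound for filters that are Lipschitz on the spectra of two symmetric shift
operators. -/
theorem opNorm_graphFilter_sub_le_of_isHermitian {N K : ℕ} {C : ℝ} (hC : 0 ≤ C) {I : Set ℝ}
    {h : Fin K → ℝ} (hh : IsLipschitzFilterOn C I h) {S T : Matrix (Fin N) (Fin N) ℝ}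
    (hS : S.IsHermitian) (hT : T.IsHermitian) (hSI : spectrum ℝ S ⊆ I) (hTI : spectrum ℝ T ⊆ I) :
    opNorm (graphFilter h T - graphFilter h S) ≤ C * Real.sqrt N * opNorm (T - S) := by
  have hδ := opNorm_nonneg (T - S)
  refine ContinuousLinearMap.opNorm_le_bound _ (by positivity) fun x => ?_
  set b := hT.eigenvectorBasis
  set D := toEuclideanCLM (n := Fin N) (𝕜 := ℝ) (graphFilter h T - graphFilter h S)
  have hD : ∀ j, ‖D (b j)‖ ≤ C * opNorm (T - S) := by
    intro j
    refine (norm_graphFilter_sub_eigenvector_le hC hh hS hSI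
      (hTI (hT.eigenvalues_mem_spectrum_real j)) (toEuclideanCLM_eigenvectorBasis hT j)).trans ?_
    have hn := norm_toEuclideanCLM_le (T - S) (b j)
    rw [b.norm_eq_one, mul_one] at hn
    exact mul_le_mul_of_nonneg_left hn hC
  -- Cauchy–Schwarz over the eigenbasis of `T`: the only source of `√N`.
  have hcs : ∑ j, ‖inner ℝ (b j) x‖ ≤ Real.sqrt N * ‖x‖ := by
    refine le_of_sq_le_sq ?_ (by positivity)
    rw [mul_pow, Real.sq_sqrt (Nat.cast_nonneg N), ← b.sum_sq_norm_inner_right x]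
    simpa using sq_sum_le_card_mul_sum_sq (s := Finset.univ) (f := fun j => ‖inner ℝ (b j) x‖)
  calc ‖D x‖ = ‖∑ j, inner ℝ (b j) x • D (b j)‖ := by
        conv_lhs => rw [← b.sum_repr' x]
        simp only [map_sum, map_smul]
    _ ≤ ∑ j, ‖inner ℝ (b j) x‖ * (C * opNorm (T - S)) := by
        refine norm_sum_le_of_le _ fun j _ => ?_
        rw [norm_smul]
        exact mul_le_mul_of_nonneg_left (hD j) (norm_nonneg _)
    _ = (∑ j, ‖inner ℝ (b j) x‖) * (C * opNorm (T - S)) := by rw [Finset.sum_mul]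
    _ ≤ (Real.sqrt N * ‖x‖) * (C * opNorm (T - S)) := by gcongr
    _ = C * Real.sqrt N * opNorm (T - S) * ‖x‖ := by ring

/-- The filter perturbation bound in both situations: Lipschitz on the line, or Lipschitz on the
spectra of two symmetric shift operators. -/
theorem opNorm_graphFilter_sub_le {N K : ℕ} {C ε : ℝ} (hC : 0 ≤ C) {I : Set ℝ}
    {S E : Matrix (Fin N) (Fin N) ℝ} (hE : opNorm E ≤ ε)
    (hI : I = Set.univ ∨ (S.IsSymm ∧ E.IsSymm ∧ spectrum ℝ S ⊆ I ∧ spectrum ℝ (S + E) ⊆ I))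
    {h : Fin K → ℝ} (hh : IsLipschitzFilterOn C I h) :
    opNorm (graphFilter h S - graphFilter h (S + E)) ≤ C * (1 + 8 * Real.sqrt N) * ε := by
  have hE0 := opNorm_nonneg E
  have hs := Real.sqrt_nonneg (N : ℝ)
  rw [opNorm_sub_comm]
  -- The two cases give the factors `1` and `√N`; both lie below `1 + 8 * √N`.
  rcases hI with rfl | ⟨hS, hE', hSI, hTI⟩
  · refine (opNorm_graphFilter_sub_le_of_lipschitz hh S E).trans ?_
    gcongr
    nlinarith
  · have hS' : S.IsHermitian := by
      rwa [Matrix.IsHermitian, Matrix.conjTranspose_eq_transpose_of_trivial]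
    have hE'' : E.IsHermitian := by
      rwa [Matrix.IsHermitian, Matrix.conjTranspose_eq_transpose_of_trivial]
    refine (opNorm_graphFilter_sub_le_of_isHermitian hC hh hS' (hS'.add hE'') hSI hTI).trans ?_
    rw [add_sub_cancel_left]
    gcongr
    linarith

/-! ### Propagation through the layers -/

/-- One layer of the network, column by column. -/
theorem GNN.output_succ {N K : ℕ} (Φ : GNN K) (l : ℕ) (j : Fin (Φ.width (l + 1)))
    (S : Matrix (Fin N) (Fin N) ℝ) (q : Signal N) :
    Φ.output (l + 1) j S q = WithLp.toLp 2 fun v => Φ.act ((∑ i,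
      toEuclideanCLM (n := Fin N) (𝕜 := ℝ) (graphFilter (Φ.taps l i j) S)
        (Φ.output l i S q)) v) := by
  ext v
  simp only [GNN.output, GNN.features, Matrix.map_apply, Matrix.sum_apply, Matrix.mul_apply,
    graphFilter, map_sum, map_smul, _root_.sum_apply,
    _root_.smul_apply, toEuclideanCLM_toLp, WithLp.ofLp_sum, Finset.sum_apply,
    WithLp.ofLp_smul, Pi.smul_apply, smul_eq_mul, Matrix.mulVec, dotProduct, GNN.taps]
  rw [Finset.sum_comm]
  simp only [mul_comm]

theorem norm_act_sub_act_le {N : ℕ} {σ : ℝ → ℝ} (hσ : LipschitzWith 1 σ) (x y : Signal N) :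
    ‖(WithLp.toLp 2 fun v => σ (x v) : Signal N) - WithLp.toLp 2 fun v => σ (y v)‖ ≤
      ‖x - y‖ := by
  rw [EuclideanSpace.norm_eq, EuclideanSpace.norm_eq]
  refine Real.sqrt_le_sqrt (Finset.sum_le_sum fun v _ => ?_)
  have h := hσ.dist_le_mul (x v) (y v)
  rw [NNReal.coe_one, one_mul, Real.dist_eq, Real.dist_eq] at h
  simp only [PiLp.sub_apply, Real.norm_eq_abs]
  gcongr

theorem norm_act_le {N : ℕ} {σ : ℝ → ℝ} (hσ : LipschitzWith 1 σ) (hσ0 : σ 0 = 0) (x : Signal N) :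
    ‖(WithLp.toLp 2 fun v => σ (x v) : Signal N)‖ ≤ ‖x‖ := by
  have h := norm_act_sub_act_le hσ x 0
  have h0 : (WithLp.toLp 2 fun v => σ ((0 : Signal N) v) : Signal N) = 0 := by
    ext v
    simp [hσ0]
  rwa [h0, sub_zero, sub_zero] at h

theorem GNN.output_zero {N K : ℕ} (Φ : GNN K) (i : Fin (Φ.width 0))
    (S : Matrix (Fin N) (Fin N) ℝ) (q : Signal N) : Φ.output 0 i S q = q := rfl

/-- In a network with normalized filters, the norms of the features that enter a layer add up to
at most one. -/
theorem GNN.sum_norm_output_le {N K F L : ℕ} (hF : 0 < F) (Φ : GNN K)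
    (S : Matrix (Fin N) (Fin N) ℝ) {q : Signal N} (hq : ‖q‖ ≤ 1)
    (hwidth : ∀ l, 0 < l → l < L → Φ.width l ≤ F)
    (hact : LipschitzWith 1 Φ.act) (hact0 : Φ.act 0 = 0)
    (hbound : ∀ l, l < L → ∀ i j, opNorm (graphFilter (Φ.taps l i j) S) ≤ 1 / (F : ℝ))
    (l : ℕ) (hl : l < L) : ∑ i, ‖Φ.output l i S q‖ ≤ 1 := by
  have hF' : (0 : ℝ) < F := Nat.cast_pos.2 hF
  induction l with
  | zero => simpa [GNN.output_zero, Φ.width_zero] using hq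
  | succ l ih =>
    have ih := ih (Nat.lt_of_succ_lt hl)
    have hcol : ∀ j, ‖Φ.output (l + 1) j S q‖ ≤ 1 / (F : ℝ) := by
      intro j
      rw [GNN.output_succ]
      refine (norm_act_le hact hact0 _).trans ?_
      calc _ ≤ ∑ i, 1 / (F : ℝ) * ‖Φ.output l i S q‖ := by
            refine norm_sum_le_of_le _ fun i _ => (norm_toEuclideanCLM_le _ _).trans ?_
            exact mul_le_mul_of_nonneg_right (hbound l (Nat.lt_of_succ_lt hl) i j)
              (norm_nonneg _)
        _ = 1 / (F : ℝ) * ∑ i, ‖Φ.output l i S q‖ := by rw [Finset.mul_sum]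
        _ ≤ 1 / (F : ℝ) * 1 := by gcongr
        _ = 1 / (F : ℝ) := mul_one _
    calc ∑ j, ‖Φ.output (l + 1) j S q‖ ≤ ∑ _j : Fin (Φ.width (l + 1)), 1 / (F : ℝ) :=
          Finset.sum_le_sum fun j _ => hcol j
      _ = Φ.width (l + 1) * (1 / (F : ℝ)) := by simp
      -- Here `l + 1 < L` must be strict: the width of the output level is not bounded by `F`.
      _ ≤ F * (1 / (F : ℝ)) := by
          gcongr
          exact hwidth _ (Nat.succ_pos l) hl
      _ = 1 := by field_simp

/-- The quotient by `ε ^ 2` of the second-order part of the error after `l` layers, for networks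
of width `F` whose filters are perturbed by at most `c * ε`. -/
noncomputable def remainderQuotient (F : ℕ) (c : ℝ) : ℕ → ℝ → ℝ
  | 0, _ => 0
  | l + 1, ε => remainderQuotient F c l ε + F * c * (l * c + ε * remainderQuotient F c l ε)

theorem continuous_remainderQuotient (F : ℕ) (c : ℝ) (l : ℕ) :
    Continuous (remainderQuotient F c l) := by
  induction l with
  | zero => exact continuous_const
  | succ l ih =>
    change Continuous fun ε => remainderQuotient F c l ε +
      F * c * (l * c + ε * remainderQuotient F c l ε)
    fun_prop

theorem remainderQuotient_nonneg (F : ℕ) {c ε : ℝ} (hc : 0 ≤ c) (hε : 0 ≤ ε) (l : ℕ) :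
    0 ≤ remainderQuotient F c l ε := by
  induction l with
  | zero => exact le_rfl
  | succ l ih =>
    unfold remainderQuotient
    positivity

/-- Stability of every feature of the network under a perturbation of its filters. -/
theorem GNN.norm_output_sub_output_le {N K F L : ℕ} (hF : 0 < F) (Φ : GNN K)
    {S T : Matrix (Fin N) (Fin N) ℝ} {q : Signal N} (hq : ‖q‖ ≤ 1) {c ε : ℝ} (hc : 0 ≤ c)
    (hε : 0 ≤ ε) (hwidth : ∀ l, 0 < l → l < L → Φ.width l ≤ F)
    (hact : LipschitzWith 1 Φ.act) (hact0 : Φ.act 0 = 0)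
    (hbound : ∀ l, l < L → ∀ i j, opNorm (graphFilter (Φ.taps l i j) S) ≤ 1 / (F : ℝ))
    (hpert : ∀ l, l < L → ∀ i j,
      opNorm (graphFilter (Φ.taps l i j) S - graphFilter (Φ.taps l i j) T) ≤ c * ε)
    (l : ℕ) (hl : l ≤ L) (j : Fin (Φ.width l)) :
    ‖Φ.output l j S q - Φ.output l j T q‖ ≤
      c * l * ε + ε ^ 2 * remainderQuotient F c l ε := by
  have hF' : (0 : ℝ) < F := Nat.cast_pos.2 hF
  induction l with
  | zero => simp [GNN.output_zero, remainderQuotient]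
  | succ l ih =>
    have ih := ih (Nat.le_of_succ_le hl)
    have hg := remainderQuotient_nonneg F hc hε l
    set d := c * l * ε + ε ^ 2 * remainderQuotient F c l ε with hd
    have hd0 : 0 ≤ d := by positivity
    have hw : (Φ.width l : ℝ) ≤ F := by
      rcases Nat.eq_zero_or_pos l with rfl | hpos
      · rw [Φ.width_zero]
        exact_mod_cast hF
      · exact_mod_cast hwidth l hpos hl
    have hsum := Φ.sum_norm_output_le hF S hq hwidth hact hact0 hbound l hl
    have hterm : ∀ i, ‖toEuclideanCLM (n := Fin N) (𝕜 := ℝ) (graphFilter (Φ.taps l i j) S)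
          (Φ.output l i S q) -
        toEuclideanCLM (n := Fin N) (𝕜 := ℝ) (graphFilter (Φ.taps l i j) T)
          (Φ.output l i T q)‖ ≤
        1 / (F : ℝ) * d + c * ε * (‖Φ.output l i S q‖ + d) := by
      intro i
      have hT : ‖Φ.output l i T q‖ ≤ ‖Φ.output l i S q‖ + d := by
        have h1 := norm_sub_norm_le (Φ.output l i T q) (Φ.output l i S q)
        rw [norm_sub_rev] at h1
        linarith [ih i]
      -- Only the filters of `S` are normalized, so `T` enters through the filter difference and
      -- through features controlled by `hT`.
      have hsplit : toEuclideanCLM (n := Fin N) (𝕜 := ℝ) (graphFilter (Φ.taps l i j) S)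
            (Φ.output l i S q) -
          toEuclideanCLM (n := Fin N) (𝕜 := ℝ) (graphFilter (Φ.taps l i j) T)
            (Φ.output l i T q) =
          toEuclideanCLM (n := Fin N) (𝕜 := ℝ) (graphFilter (Φ.taps l i j) S)
            (Φ.output l i S q - Φ.output l i T q) +
          toEuclideanCLM (n := Fin N) (𝕜 := ℝ)
            (graphFilter (Φ.taps l i j) S - graphFilter (Φ.taps l i j) T)
            (Φ.output l i T q) := by
        rw [map_sub, map_sub, _root_.sub_apply]
        abel
      rw [hsplit]
      refine norm_add_le_of_le ((norm_toEuclideanCLM_le _ _).trans ?_)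
        ((norm_toEuclideanCLM_le _ _).trans ?_)
      · exact mul_le_mul (hbound l hl i j) (ih i) (norm_nonneg _) (by positivity)
      · exact mul_le_mul (hpert l hl i j) hT (norm_nonneg _) (by positivity)
    rw [GNN.output_succ, GNN.output_succ]
    refine (norm_act_sub_act_le hact _ _).trans ?_
    rw [← Finset.sum_sub_distrib]
    calc _ ≤ ∑ i, (1 / (F : ℝ) * d + c * ε * (‖Φ.output l i S q‖ + d)) :=
          norm_sum_le_of_le _ fun i _ => hterm i
      _ = Φ.width l * (1 / (F : ℝ) * d + c * ε * d) +
            c * ε * ∑ i, ‖Φ.output l i S q‖ := by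
          simp only [mul_add, Finset.sum_add_distrib, Finset.mul_sum, Finset.sum_const,
            Finset.card_univ, Fintype.card_fin, nsmul_eq_mul]
          ring
      _ ≤ F * (1 / (F : ℝ) * d + c * ε * d) + c * ε * 1 := by gcongr
      _ = c * ↑(l + 1) * ε + ε ^ 2 * remainderQuotient F c (l + 1) ε := by
          rw [hd, remainderQuotient]
          push_cast
          field_simp
          ring

/-! ### Means over samples and the final bound -/

/-- A mean of `M` vectors of norm at most `B` has norm at most `B`, also for `M = 0`. -/
theorem norm_mean_le {E : Type*} [NormedAddCommGroup E] [NormedSpace ℝ E] {M : ℕ} {B : ℝ}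
    (hB : 0 ≤ B) {x : Fin M → E} (hx : ∀ m, ‖x m‖ ≤ B) :
    ‖(1 / (M : ℝ)) • ∑ m, x m‖ ≤ B := by
  rw [norm_smul, Real.norm_of_nonneg (by positivity)]
  rcases Nat.eq_zero_or_pos M with rfl | hM
  · simpa using hB
  · have hM' : (0 : ℝ) < M := Nat.cast_pos.2 hM
    calc 1 / (M : ℝ) * ‖∑ m, x m‖ ≤ 1 / (M : ℝ) * ∑ _m : Fin M, B := by
          gcongr
          exact norm_sum_le_of_le _ fun m _ => hx m
      _ = B := by
          simp only [Finset.sum_const, Finset.card_univ, Fintype.card_fin, nsmul_eq_mul]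
          field_simp

theorem norm_rPearl_sub_rPearl_le {N K M L : ℕ} (Φ : GNN K) (f : Fin (Φ.width L))
    {S T : Matrix (Fin N) (Fin N) ℝ} {B : ℝ} (hB : 0 ≤ B) {q : Fin M → Signal N}
    (h : ∀ m, ‖Φ.output L f S (q m) - Φ.output L f T (q m)‖ ≤ B) :
    ‖rPearl Φ L f S q - rPearl Φ L f T q‖ ≤ B := by
  rw [rPearl, rPearl, ← smul_sub, ← Finset.sum_sub_distrib]
  exact norm_mean_le hB h

theorem enorm_le_ofReal {E : Type*} [NormedAddCommGroup E] {x : E} {B : ℝ} (h : ‖x‖ ≤ B) :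
    ‖x‖ₑ ≤ ENNReal.ofReal B := by
  rw [← ofReal_norm]
  exact ENNReal.ofReal_le_ofReal h

end Pearl

/-- The remainder `r` depends on `N`, `F`, `L`, `C` only, so the bound is uniform in the shift
operator (in particular in its eigengaps), the perturbation, the network and the number of
samples.  The last alternative in `_hI` covers filters that are Lipschitz just on a set containing
the spectra of two symmetric shift operators; for `I = Set.univ` no symmetry is needed. -/
theorem mainTheorem3 (N F L : ℕ) (hF : 0 < F) (C : ℝ) (hC : 0 ≤ C) :
    ∃ r : ℝ → ℝ, Asymptotics.IsBigO (nhds 0) r (fun ε : ℝ => ε ^ 2) ∧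
      ∀ (K : ℕ) (Φ : Pearl.GNN K) (S E : Matrix (Fin N) (Fin N) ℝ) (ε : ℝ) (I : Set ℝ)
        (_hwidth : ∀ l, 0 < l → l < L → Φ.width l ≤ F)
        (_hact : LipschitzWith 1 Φ.act) (_hact0 : Φ.act 0 = 0)
        (_hE : Pearl.opNorm E ≤ ε)
        (_hI : I = Set.univ ∨
          (S.IsSymm ∧ E.IsSymm ∧ spectrum ℝ S ⊆ I ∧ spectrum ℝ (S + E) ⊆ I))
        (_hLip : ∀ l, l < L → ∀ i j, Pearl.IsLipschitzFilterOn C I (Φ.taps l i j))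
        (_hbound : ∀ l, l < L → ∀ i j,
          Pearl.opNorm (Pearl.graphFilter (Φ.taps l i j) S) ≤ 1 / (F : ℝ))
        (f : Fin (Φ.width L)),
        (∀ M : ℕ,
          Pearl.opDistMulti (M := M) (Pearl.rPearl Φ L f S) (Pearl.rPearl Φ L f (S + E)) ≤
              ENNReal.ofReal (C * (1 + 8 * Real.sqrt N) * L * ε + r ε) ∧
          Pearl.opDist (fun x => Pearl.rPearl Φ L f S (fun _ : Fin M => x))
              (fun x => Pearl.rPearl Φ L f (S + E) (fun _ : Fin M => x)) ≤
              ENNReal.ofReal (C * (1 + 8 * Real.sqrt N) * L * ε + r ε)) ∧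
        Pearl.signalDist ((1 / (N : ℝ)) • Pearl.bPearl Φ L f S)
            ((1 / (N : ℝ)) • Pearl.bPearl Φ L f (S + E)) ≤
          ENNReal.ofReal (C * (1 + 8 * Real.sqrt N) * L * ε + r ε) := by
  set c : ℝ := C * (1 + 8 * Real.sqrt N) with hc_def
  have hc : 0 ≤ c := by positivity
  refine ⟨fun ε => ε ^ 2 * Pearl.remainderQuotient F c L ε, ?_, ?_⟩
  · have h1 : Asymptotics.IsBigO (nhds 0) (Pearl.remainderQuotient F c L) (fun _ => (1 : ℝ)) :=
      ((Pearl.continuous_remainderQuotient F c L).tendsto 0).isBigO_one ℝ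
    simpa using (Asymptotics.isBigO_refl (fun ε : ℝ => ε ^ 2) (nhds 0)).mul h1
  intro K Φ S E ε I hwidth hact hact0 hE hI hLip hbound f
  have hε : 0 ≤ ε := (Pearl.opNorm_nonneg E).trans hE
  have hout : ∀ q : Pearl.Signal N, ‖q‖ = 1 →
      ‖Φ.output L f S q - Φ.output L f (S + E) q‖ ≤
        c * L * ε + ε ^ 2 * Pearl.remainderQuotient F c L ε := fun q hq =>
    Φ.norm_output_sub_output_le hF hq.le hc hε hwidth hact hact0 hbound
      (fun l hl i j => Pearl.opNorm_graphFilter_sub_le hC hE hI (hLip l hl i j)) L le_rfl f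
  have hB : 0 ≤ c * L * ε + ε ^ 2 * Pearl.remainderQuotient F c L ε := by
    have := Pearl.remainderQuotient_nonneg F hc hε L
    positivity
  refine ⟨fun M => ⟨?_, ?_⟩, ?_⟩
  -- Permuting by `1` changes nothing, definitionally.
  · refine iInf_le_of_le 1 (iSup₂_le fun q hq => Pearl.enorm_le_ofReal ?_)
    exact Pearl.norm_rPearl_sub_rPearl_le Φ f hB fun m => hout _ (hq m)
  · refine iInf_le_of_le 1 (iSup₂_le fun x hx => Pearl.enorm_le_ofReal ?_)
    exact Pearl.norm_rPearl_sub_rPearl_le Φ f hB fun _ => hout _ hx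
  · refine iInf_le_of_le 1 (Pearl.enorm_le_ofReal ?_)
    -- The averaged B-PEARL encoding unfolds to `rPearl` on the `N` basis vectors, which have norm
    -- one.
    exact Pearl.norm_rPearl_sub_rPearl_le Φ f hB fun m => hout _ (by simp)
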